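/- Fix an integer $n\ge 0$. For $1\le i\le n-1$ let $s_i\in S_n$ be the transposition swapping $i$ and $i+1$, and let $\ell(w)$ be the least $\ell$ such that $w=s_{i_1}\cdots s_{i_\ell}$ for some $i_1,\dots,i_\ell$; when $\ell=\ell(w)$ the word $[i_1\cdots i_\ell]$ is a reduced word of $w$. The Bruhat order on $S_n$ is the transitive and reflexive closure of the relations $u<ut$ with $t$ a transposition and $\ell(u)<\ell(ut)$. A permutation $w\in S_n$ is boolean if the principal order ideal of $w$ in the Bruhat order is isomorphic to a boolean algebra. Let $w\in S_n$ be boolean. The heap $H_w$ is the set of letters appearing in reduced words of $w$, with the partial order that is the transitive closure of the following relations, for letters $i,i+1\in H_w$: $i\prec i+1$ if $i$ appears to the left of $i+1$ in every reduced word of $w$, and $i\succ i+1$ otherwise. The canonical reduced word of $w$ is a concatenation of runs, constructed recursively as follows from $H=H_w$; the empty $H$ gives the empty word. Let $a$ be the smallest letter in $H$. (a) If $a+1\notin H$, it is the run $a$ followed by the word constructed from $H\setminus\{a\}$. Otherwise let $b$ be the smallest letter greater than $a$ that is a minimal or maximal element of the poset $H$. (b) If $a\succ a+1$, it is the run $b(b-1)\cdots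 a$ followed by the word constructed from $H\setminus\{a,a+1,\dots,b\}$. (c) If $a\prec a+1$, it is the word constructed from $H\setminus\{a,a+1,\dots,b\}$ followed by the run $a(a+1)\cdots b$. The runs $a$, $b(b-1)\cdots a$ and $a(a+1)\cdots b$ placed in these steps are the runs of the canonical reduced word. A set $M$ of integers is uncrowded if $|[y,y+2x]\cap M|\le x+1$ for all integers $x,y$ with $x>0$, where $[y,y+2x]$ denotes the set of integers from $y$ to $y+2x$. **Theorem.** Let $L$ be a subset of $\{1,\dots,n-1\}$. Then $L\cup\{0\}$ is uncrowded if and only if there is a boolean permutation $w\in S_n$ such that $L$ is the set of leftmost letters of the runs of the canonical reduced word of $w$. -/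

import Mathlib

namespace BooleanPermutation

/-- The simple reflection `s_i` of `S_n`, for a letter `1 ≤ i ≤ n - 1`. The symmetric group `S_n` is
`Equiv.Perm (Fin n)`, where the element `j` of `{1, …, n}` is represented by `j - 1 : Fin n`;
so `s_i` swaps the elements `i - 1` and `i` of `Fin n`.
(Other values of `i` are never letters of a word; there the value is the identity.) -/
def simpleReflection (n i : ℕ) : Equiv.Perm (Fin n) :=
  if h : 1 ≤ i ∧ i < n then Equiv.swap ⟨i - 1, by omega⟩ ⟨i, h.2⟩ else 1

/-- `s` is a word whose letters all lie in `{1, …, n - 1}`. -/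
def IsWord (n : ℕ) (s : List ℕ) : Prop :=
  ∀ i ∈ s, 1 ≤ i ∧ i < n

/-- The product `s_{i_1} ⋯ s_{i_ℓ}` for the word `[i_1, …, i_ℓ]`. -/
def wordProd (n : ℕ) (s : List ℕ) : Equiv.Perm (Fin n) :=
  (s.map (simpleReflection n)).prod

/-- The Coxeter length: the least number of simple reflections whose product is `w`. -/
noncomputable def length {n : ℕ} (w : Equiv.Perm (Fin n)) : ℕ :=
  sInf {l : ℕ | ∃ s : List ℕ, IsWord n s ∧ wordProd n s = w ∧ s.length = l}

/-- `s` is a reduced word of `w`, that is, `s ∈ R(w)`. -/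
def IsReducedWord {n : ℕ} (w : Equiv.Perm (Fin n)) (s : List ℕ) : Prop :=
  IsWord n s ∧ wordProd n s = w ∧ s.length = length w

/-- One step up in the Bruhat order: multiplication by a reflection (a transposition) that
increases the length. -/
def BruhatStep {n : ℕ} (u v : Equiv.Perm (Fin n)) : Prop :=
  ∃ i j : Fin n, i ≠ j ∧ v = u * Equiv.swap i j ∧ length u < length v

/-- The (strong) Bruhat order on `S_n`. -/
def BruhatLE {n : ℕ} (u v : Equiv.Perm (Fin n)) : Prop :=
  Relation.ReflTransGen BruhatStep u v

/-- `w` is boolean: its principal order ideal in the Bruhat order is isomorphic to a (finite)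
boolean algebra, i.e. to the set of all subsets of a `k`-element set ordered by inclusion. -/
def IsBoolean {n : ℕ} (w : Equiv.Perm (Fin n)) : Prop :=
  ∃ k : ℕ, Nonempty
    ((fun u v : {u : Equiv.Perm (Fin n) // BruhatLE u w} => BruhatLE u.1 v.1) ≃r
      (fun A B : Finset (Fin k) => A ⊆ B))

open Classical in
/-- The support of `w`: the letters that appear in reduced words of `w`. -/
noncomputable def support {n : ℕ} (w : Equiv.Perm (Fin n)) : Finset ℕ :=
  (Finset.Ico 1 n).filter (fun i => ∃ s : List ℕ, IsReducedWord w s ∧ i ∈ s)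

/-- `i` appears to the left of `j` in every reduced word of `w`. -/
def AlwaysLeft {n : ℕ} (w : Equiv.Perm (Fin n)) (i j : ℕ) : Prop :=
  ∀ s : List ℕ, IsReducedWord w s → List.Sublist [i, j] s

/-- The cover relations of the heap of `w`, for `i` and `i + 1` in the support:
`i ≺ i + 1` if `i` is to the left of `i + 1` in every reduced word, and `i + 1 ≺ i` otherwise. -/
def HeapCover {n : ℕ} (w : Equiv.Perm (Fin n)) (x y : ℕ) : Prop :=
  x ∈ support w ∧ y ∈ support w ∧
    ((y = x + 1 ∧ AlwaysLeft w x y) ∨ (x = y + 1 ∧ ¬ AlwaysLeft w y x))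

/-- The strict order `≺` of the heap of `w`. -/
def HeapLT {n : ℕ} (w : Equiv.Perm (Fin n)) : ℕ → ℕ → Prop :=
  Relation.TransGen (HeapCover w)

/-- `b` is an extremal (minimal or maximal) element of the set `H` ordered by `lt`. -/
def IsExtremal (lt : ℕ → ℕ → Prop) (H : Finset ℕ) (b : ℕ) : Prop :=
  b ∈ H ∧ ((∀ c ∈ H, ¬ lt c b) ∨ (∀ c ∈ H, ¬ lt b c))

open Classical in
/-- The first extremal element of `H` to the right of `a`, i.e. the smallest extremal number
greater than `a` (the default value `a` is irrelevant for the construction below). -/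
noncomputable def firstExtremal (lt : ℕ → ℕ → Prop) (H : Finset ℕ) (a : ℕ) : ℕ :=
  (H.filter (fun b => a < b ∧ IsExtremal lt H b)).min.untopD a

theorem le_firstExtremal (lt : ℕ → ℕ → Prop) (H : Finset ℕ) (a : ℕ) :
    a ≤ firstExtremal lt H a := by
  classical
  unfold firstExtremal
  rcases Finset.eq_empty_or_nonempty (H.filter (fun b => a < b ∧ IsExtremal lt H b)) with h | h
  · simp [h]
  · rw [← Finset.coe_min' h, WithTop.untopD_coe]
    exact (Finset.mem_filter.mp (Finset.min'_mem _ h)).2.1.le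

/-- The increasing run `a (a+1) ⋯ b`. -/
def incRun (a b : ℕ) : List ℕ := List.range' a (b + 1 - a)

/-- The decreasing run `b (b-1) ⋯ a`. -/
def decRun (a b : ℕ) : List ℕ := (incRun a b).reverse

open Classical in
/-- The list of runs, from left to right, built from a set `H` of letters ordered by `lt`.
Let `a` be the smallest letter.
If `a + 1 ∉ H`, the singleton run `a` is put on the left of the runs built from `H \ {a}`.
Otherwise let `b` be the first extremal element of `H` to the right of `a`. If `a ≻ a + 1`, the
decreasing run `b (b-1) ⋯ a` is put on the left of the runs built from `H \ {a, …, b}`, and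
if `a ≺ a + 1`, the increasing run `a (a+1) ⋯ b` is put on their right. -/
noncomputable def heapRuns (lt : ℕ → ℕ → Prop) (H : Finset ℕ) : List (List ℕ) :=
  if h : H.Nonempty then
    if H.min' h + 1 ∉ H then
      [H.min' h] :: heapRuns lt (H.erase (H.min' h))
    else if lt (H.min' h + 1) (H.min' h) then
      decRun (H.min' h) (firstExtremal lt H (H.min' h)) ::
        heapRuns lt (H \ Finset.Icc (H.min' h) (firstExtremal lt H (H.min' h)))
    else
      heapRuns lt (H \ Finset.Icc (H.min' h) (firstExtremal lt H (H.min' h))) ++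
        [incRun (H.min' h) (firstExtremal lt H (H.min' h))]
  else []
termination_by H.card
decreasing_by
  · exact Finset.card_erase_lt_of_mem (H.min'_mem h)
  all_goals
    refine Finset.card_lt_card (Finset.ssubset_iff_subset_ne.mpr ⟨Finset.sdiff_subset, ?_⟩)
    intro he
    exact (Finset.mem_sdiff.mp (he.symm.subset (H.min'_mem h))).2
      (Finset.mem_Icc.mpr ⟨le_refl _, le_firstExtremal _ _ _⟩)

/-- The runs, from left to right, of the canonical reduced word of a boolean permutation `w`. -/
noncomputable def canonicalRuns {n : ℕ} (w : Equiv.Perm (Fin n)) : List (List ℕ) :=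
  heapRuns (HeapLT w) (support w)

/-- The canonical reduced word of a boolean permutation `w`: the concatenation of its runs. -/
noncomputable def canonicalWord {n : ℕ} (w : Equiv.Perm (Fin n)) : List ℕ :=
  (canonicalRuns w).flatten

/-- The set of leftmost letters of the runs of the canonical reduced word of `w`. -/
def runLeads {n : ℕ} (w : Equiv.Perm (Fin n)) : Set ℕ :=
  {i : ℕ | ∃ r ∈ canonicalRuns w, r.head? = some i}

/-- A set of integers is uncrowded if every interval `[y, y + 2x]` with `x > 0` contains at most
`x + 1` of its elements. -/
def Uncrowded (L : Set ℤ) : Prop :=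
  ∀ x y : ℤ, 0 < x → ((Set.Icc y (y + 2 * x) ∩ L).ncard : ℤ) ≤ x + 1

end BooleanPermutation

/-!
Only two things about a permutation `w` enter the set of leads of its runs: the support of `w` and
the direction of the heap relation between consecutive letters of the support. Whatever `w` is, this
is an orientation of a graph whose components are paths.

*Leads are uncrowded.* Reading the letters from left to right, each run can be given a block of at
least two consecutive integers, disjoint from the other blocks, that contains exactly one lead: a run
`{a, …, b}` with `a < b` is its own block, and a run `{a}` is followed by a letter `a + 1` outside
the heap, which completes its block. So a half-open interval `(c, c + 2x]` starting at the end of a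
block has at most `x` leads, and `[y, y + 2x]` has at most `x + 1`. The property `Sparse c`
packages these bounds; for `c = 0` it says that adjoining `0` gives an uncrowded set
(`uncrowded_iff_sparse`, `sparse_runLeads`).

*Uncrowded sets are sets of leads.* Scanning `L` greedily from the left, one of three moves keeps
`Sparse c` true with `c` replaced by a larger number: skip `c + 1` if neither `c + 1` nor `c + 2` is
in `L`; use `{c + 1}` as a singleton run, and leave `c + 2` out, if `c + 1 ∈ L`; use
`(c + 2)(c + 1)` as a decreasing run if `c + 2 ∈ L`. Sparsity
excludes that both are in `L`. For the resulting set of letters the orientation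
`i ≺ i + 1 ↔ i ∈ L` makes exactly these words the runs (`exists_heap`).

Every set of letters with every orientation comes from a word without repeated letters
(`orientedWord`). For such a word the product `w` determines the letters, as `i` is absent exactly
when `w` preserves `{x | x < i}`, and the order of `i` and `i + 1`, which is read off by comparing
`w i` with `i`. So the word is reduced and has the prescribed heap. The strong exchange property
(`exchange`) shows that the permutations below `w` are the products of the subwords, and these are in
order-preserving bijection with the subsets of the letters (`isBoolean_wordProd`).
-/

namespace BooleanPermutation

/-! ### Counting in uncrowded sets -/

/-- `L` has at most `x` elements in `(c, c + 2x]`, and at most `x + 1` in every `[y, y + 2x]` that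
lies to the right of `c`: the part of `L` beyond `c`, with `c` adjoined, is uncrowded. -/
def Sparse (c : ℕ) (L : Set ℕ) : Prop :=
  (∀ x, (L ∩ Set.Ioc c (c + 2 * x)).ncard ≤ x) ∧
    ∀ y x, c < y → (L ∩ Set.Icc y (y + 2 * x)).ncard ≤ x + 1

theorem ncard_inter_le {L A B : Set ℕ} (hB : B.Finite) (h : L ∩ A ⊆ B) :
    (L ∩ A).ncard ≤ (L ∩ B).ncard :=
  Set.ncard_le_ncard (fun _ hx => ⟨hx.1, h hx⟩) (hB.subset Set.inter_subset_right)

theorem sparse_empty (c : ℕ) : Sparse c ∅ := by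
  simp [Sparse]

/-- Prefixing a block `(c, b]` of at least two integers with one lead `l` preserves sparsity. -/
theorem Sparse.insert {c b l : ℕ} {L : Set ℕ} (h : Sparse b L) (hL : ∀ x ∈ L, b < x)
    (hcb : c + 2 ≤ b) (hlb : l ≤ b) : Sparse c (insert l L) := by
  have key : ∀ (A : Set ℕ) (x : ℕ), (∀ z ∈ A, z ≤ b + 2 * x) → (L ∩ A).ncard ≤ x := by
    intro A x hA
    refine (ncard_inter_le (Set.finite_Ioc b (b + 2 * x)) ?_).trans (h.1 x)
    exact fun z hz => ⟨hL z hz.1, hA z hz.2⟩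
  have one : ∀ A : Set ℕ, (Insert.insert l L ∩ A).ncard ≤ (L ∩ A).ncard + 1 := by
    intro A
    by_cases hl : l ∈ A
    · rw [Set.insert_inter_of_mem hl]
      exact Set.ncard_insert_le _ _
    · rw [Set.insert_inter_of_notMem hl]
      exact Nat.le_succ _
  refine ⟨fun x => ?_, fun y x hy => ?_⟩
  · rcases Nat.eq_zero_or_pos x with rfl | hx
    · simp
    · have h1 := one (Set.Ioc c (c + 2 * x))
      have h2 := key (Set.Ioc c (c + 2 * x)) (x - 1)
        (by rintro z ⟨_, hz⟩; omega)
      omega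
  · by_cases hyb : y ≤ b
    · have h1 := one (Set.Icc y (y + 2 * x))
      have h2 := key (Set.Icc y (y + 2 * x)) x (by rintro z ⟨_, hz⟩; omega)
      omega
    · rw [Set.insert_inter_of_notMem (by rintro ⟨hz, _⟩; omega)]
      exact h.2 y x (by omega)

theorem Sparse.succ {c : ℕ} {L : Set ℕ} (h : Sparse c L) (h2 : c + 2 ∉ L) :
    Sparse (c + 1) L := by
  refine ⟨fun x => ?_, fun y x hy => h.2 y x (by omega)⟩
  rcases x with _ | x
  · simp
  · refine (ncard_inter_le (Set.finite_Icc (c + 3) (c + 3 + 2 * x)) ?_).trans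
      (h.2 (c + 3) x (by omega))
    rintro z ⟨hz, hz1, hz2⟩
    have : z ≠ c + 2 := by rintro rfl; exact h2 hz
    exact ⟨by omega, by omega⟩

theorem Sparse.add_two {c l : ℕ} {L : Set ℕ} (h : Sparse c L) (hl : l ∈ L) (hcl : c < l)
    (hlc : l ≤ c + 2) : Sparse (c + 2) L := by
  refine ⟨fun x => ?_, fun y x hy => h.2 y x (by omega)⟩
  have h1 := h.1 (x + 1)
  have hfin : (L ∩ Set.Ioc (c + 2) (c + 2 + 2 * x)).Finite :=
    (Set.finite_Ioc _ _).subset Set.inter_subset_right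
  have hsub : Insert.insert l (L ∩ Set.Ioc (c + 2) (c + 2 + 2 * x)) ⊆
      L ∩ Set.Ioc c (c + 2 * (x + 1)) := by
    rintro z (rfl | ⟨hz, hz1, hz2⟩)
    · exact ⟨hl, hcl, by omega⟩
    · exact ⟨hz, by omega, by omega⟩
  have h2 := Set.ncard_le_ncard hsub ((Set.finite_Ioc _ _).subset Set.inter_subset_right)
  rw [Set.ncard_insert_of_notMem (by rintro ⟨_, h, _⟩; omega) hfin] at h2
  omega

theorem Sparse.not_mem_both {c : ℕ} {L : Set ℕ} (h : Sparse c L) (h1 : c + 1 ∈ L) :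
    c + 2 ∉ L := by
  intro h2
  have hsub : ({c + 1, c + 2} : Set ℕ) ⊆ L ∩ Set.Ioc c (c + 2 * 1) := by
    rintro z (rfl | rfl)
    · exact ⟨h1, by simp⟩
    · exact ⟨h2, by simp⟩
  have := Set.ncard_le_ncard hsub ((Set.finite_Ioc _ _).subset Set.inter_subset_right)
  rw [Set.ncard_pair (by omega)] at this
  have := h.1 1
  omega

theorem uncrowded_iff_sparse {L : Set ℕ} (hL : ∀ i ∈ L, 1 ≤ i) :
    Uncrowded ((fun i : ℕ => (i : ℤ)) '' L ∪ {0}) ↔ Sparse 0 L := by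
  have hinj : Function.Injective (fun i : ℕ => (i : ℤ)) := Nat.cast_injective
  constructor
  · intro h
    refine ⟨fun x => ?_, fun y x hy => ?_⟩
    · rcases Nat.eq_zero_or_pos x with rfl | hx
      · simp
      have h1 := h x 0 (by exact_mod_cast hx)
      have hsub : Insert.insert (0 : ℤ)
          ((fun i : ℕ => (i : ℤ)) '' (L ∩ Set.Ioc 0 (0 + 2 * x))) ⊆
          Set.Icc (0 : ℤ) (0 + 2 * x) ∩ ((fun i : ℕ => (i : ℤ)) '' L ∪ {0}) := by
        rintro z (rfl | ⟨i, ⟨hi, hi1, hi2⟩, rfl⟩)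
        · exact ⟨⟨le_refl _, by positivity⟩, Or.inr rfl⟩
        · exact ⟨⟨by positivity, by simp only; omega⟩, Or.inl ⟨i, hi, rfl⟩⟩
      have h2 := Set.ncard_le_ncard hsub ((Set.finite_Icc _ _).subset Set.inter_subset_left)
      rw [Set.ncard_insert_of_notMem, Set.ncard_image_of_injective _ hinj] at h2
      · omega
      · rintro ⟨i, ⟨hi, hi1, hi2⟩, h0⟩
        simp only at h0
        omega
    · rcases Nat.eq_zero_or_pos x with rfl | hx
      · refine (Set.ncard_le_ncard Set.inter_subset_right (Set.finite_Icc _ _)).trans ?_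
        simp
      have h1 := h x y (by exact_mod_cast hx)
      have hsub : (fun i : ℕ => (i : ℤ)) '' (L ∩ Set.Icc y (y + 2 * x)) ⊆
          Set.Icc (y : ℤ) (y + 2 * x) ∩ ((fun i : ℕ => (i : ℤ)) '' L ∪ {0}) := by
        rintro z ⟨i, ⟨hi, hi1, hi2⟩, rfl⟩
        exact ⟨⟨by simp only; omega, by simp only; omega⟩, Or.inl ⟨i, hi, rfl⟩⟩
      have h2 := Set.ncard_le_ncard hsub ((Set.finite_Icc _ _).subset Set.inter_subset_left)
      rw [Set.ncard_image_of_injective _ hinj] at h2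
      omega
  · intro h x y hx
    lift x to ℕ using hx.le
    by_cases hy : 0 < y
    · lift y to ℕ using hy.le
      have hsub : Set.Icc (y : ℤ) (y + 2 * x) ∩ ((fun i : ℕ => (i : ℤ)) '' L ∪ {0}) ⊆
          (fun i : ℕ => (i : ℤ)) '' (L ∩ Set.Icc y (y + 2 * x)) := by
        rintro z ⟨⟨hz1, hz2⟩, ⟨i, hi, rfl⟩ | rfl⟩
        · simp only at hz1 hz2
          exact ⟨i, ⟨hi, by omega, by omega⟩, rfl⟩
        · omega
      have h2 := Set.ncard_le_ncard hsub
        (((Set.finite_Icc _ _).subset Set.inter_subset_right).image _)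
      rw [Set.ncard_image_of_injective _ hinj] at h2
      have := h.2 y x (by omega)
      omega
    · have hsub : Set.Icc y (y + 2 * x) ∩ ((fun i : ℕ => (i : ℤ)) '' L ∪ {0}) ⊆
          Insert.insert (0 : ℤ) ((fun i : ℕ => (i : ℤ)) '' (L ∩ Set.Ioc 0 (0 + 2 * x))) := by
        rintro z ⟨⟨hz1, hz2⟩, ⟨i, hi, rfl⟩ | rfl⟩
        · simp only at hz1 hz2
          have := hL i hi
          exact Or.inr ⟨i, ⟨hi, by omega, by omega⟩, rfl⟩
        · exact Or.inl rfl
      have h2 := Set.ncard_le_ncard hsub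
        ((((Set.finite_Ioc _ _).subset Set.inter_subset_right).image _).insert _)
      have h3 := Set.ncard_insert_le (0 : ℤ)
        ((fun i : ℕ => (i : ℤ)) '' (L ∩ Set.Ioc 0 (0 + 2 * x)))
      rw [Set.ncard_image_of_injective _ hinj] at h3
      have := h.1 x
      omega

/-! ### Leads of the runs of an oriented path -/

/-- The leftmost letters of the runs constructed from the set `H` of letters ordered by `lt`. -/
def heapLeads (lt : ℕ → ℕ → Prop) (H : Finset ℕ) : Set ℕ :=
  {i | ∃ r ∈ heapRuns lt H, r.head? = some i}

/-- `R` only relates consecutive integers in `S`, each pair in at most one direction: the cover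
relation of a heap with set of letters `S`. -/
structure IsPathOrientation (S : Finset ℕ) (R : ℕ → ℕ → Prop) : Prop where
  mem_left : ∀ {x y}, R x y → x ∈ S
  mem_right : ∀ {x y}, R x y → y ∈ S
  adj : ∀ {x y}, R x y → y = x + 1 ∨ x = y + 1
  asymm : ∀ {x y}, R x y → ¬ R y x

theorem heapLeads_empty (lt : ℕ → ℕ → Prop) : heapLeads lt ∅ = ∅ := by
  simp [heapLeads, heapRuns]

theorem min'_filter {S : Finset ℕ} {a c : ℕ} (ha : a ∈ S) (hca : c < a)
    (hmin : ∀ x ∈ S, c < x → a ≤ x) (hne : (S.filter (c < ·)).Nonempty) :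
    (S.filter (c < ·)).min' hne = a := by
  apply le_antisymm
  · exact Finset.min'_le _ _ (Finset.mem_filter.2 ⟨ha, hca⟩)
  · refine Finset.le_min' _ _ _ fun x hx => ?_
    exact hmin x (Finset.mem_filter.1 hx).1 (Finset.mem_filter.1 hx).2

theorem incRun_head? {a b : ℕ} (h : a ≤ b) : (incRun a b).head? = some a := by
  obtain ⟨k, rfl⟩ := Nat.exists_eq_add_of_le h
  have : a + k + 1 - a = k + 1 := by omega
  rw [incRun, this, List.range'_succ]
  rfl

theorem decRun_head? {a b : ℕ} (h : a ≤ b) : (decRun a b).head? = some b := by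
  obtain ⟨k, rfl⟩ := Nat.exists_eq_add_of_le h
  have : a + k + 1 - a = k + 1 := by omega
  rw [decRun, incRun, this, List.range'_concat]
  simp

section Leads

variable {lt : ℕ → ℕ → Prop} {S : Finset ℕ} {a c : ℕ}

theorem heapLeads_singleton (ha : a ∈ S) (hca : c < a) (hmin : ∀ x ∈ S, c < x → a ≤ x)
    (h1 : a + 1 ∉ S) :
    heapLeads lt (S.filter (c < ·)) = insert a (heapLeads lt (S.filter (a + 1 < ·))) := by
  have hne : (S.filter (c < ·)).Nonempty := ⟨a, Finset.mem_filter.2 ⟨ha, hca⟩⟩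
  have hm := min'_filter ha hca hmin hne
  have hset : (S.filter (c < ·)).erase a = S.filter (a + 1 < ·) := by
    ext x
    simp only [Finset.mem_erase, Finset.mem_filter]
    constructor
    · rintro ⟨h, hx, hcx⟩
      have := hmin x hx hcx
      have : x ≠ a + 1 := by rintro rfl; exact h1 hx
      exact ⟨hx, by omega⟩
    · rintro ⟨hx, h⟩
      exact ⟨by omega, hx, by omega⟩
  have h1' : a + 1 ∉ S.filter (c < ·) := fun h => h1 (Finset.mem_filter.1 h).1
  ext i
  rw [heapLeads, heapRuns, dif_pos hne, hm, if_pos h1', hset]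
  simp [heapLeads, eq_comm]

theorem filter_sdiff_Icc {b : ℕ} (hmin : ∀ x ∈ S, c < x → a ≤ x) (hca : c < a) (hab : a ≤ b) :
    S.filter (c < ·) \ Finset.Icc a b = S.filter (b < ·) := by
  ext x
  simp only [Finset.mem_sdiff, Finset.mem_filter, Finset.mem_Icc]
  constructor
  · rintro ⟨⟨hx, hcx⟩, h⟩
    have := hmin x hx hcx
    exact ⟨hx, by omega⟩
  · rintro ⟨hx, h⟩
    exact ⟨⟨hx, by omega⟩, by omega⟩

theorem heapLeads_dec (ha : a ∈ S) (hca : c < a) (hmin : ∀ x ∈ S, c < x → a ≤ x)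
    (h1 : a + 1 ∈ S) (hlt : lt (a + 1) a) :
    heapLeads lt (S.filter (c < ·)) = insert (firstExtremal lt (S.filter (c < ·)) a)
      (heapLeads lt (S.filter (firstExtremal lt (S.filter (c < ·)) a < ·))) := by
  have hne : (S.filter (c < ·)).Nonempty := ⟨a, Finset.mem_filter.2 ⟨ha, hca⟩⟩
  have hm := min'_filter ha hca hmin hne
  have h1' : ¬ a + 1 ∉ S.filter (c < ·) := not_not.2 (Finset.mem_filter.2 ⟨h1, by omega⟩)
  have hle := le_firstExtremal lt (S.filter (c < ·)) a
  ext i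
  rw [heapLeads, heapRuns, dif_pos hne, hm, if_neg h1', if_pos hlt,
    filter_sdiff_Icc hmin hca hle]
  simp [heapLeads, decRun_head? hle, eq_comm]

theorem heapLeads_inc (ha : a ∈ S) (hca : c < a) (hmin : ∀ x ∈ S, c < x → a ≤ x)
    (h1 : a + 1 ∈ S) (hlt : ¬ lt (a + 1) a) :
    heapLeads lt (S.filter (c < ·)) = insert a
      (heapLeads lt (S.filter (firstExtremal lt (S.filter (c < ·)) a < ·))) := by
  have hne : (S.filter (c < ·)).Nonempty := ⟨a, Finset.mem_filter.2 ⟨ha, hca⟩⟩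
  have hm := min'_filter ha hca hmin hne
  have h1' : ¬ a + 1 ∉ S.filter (c < ·) := not_not.2 (Finset.mem_filter.2 ⟨h1, by omega⟩)
  have hle := le_firstExtremal lt (S.filter (c < ·)) a
  ext i
  rw [heapLeads, heapRuns, dif_pos hne, hm, if_neg h1', if_neg hlt,
    filter_sdiff_Icc hmin hca hle]
  simp [heapLeads, or_and_right, exists_or, incRun_head? hle, eq_comm, or_comm]

end Leads

theorem lt_firstExtremal {lt : ℕ → ℕ → Prop} {H : Finset ℕ} {a b : ℕ} (hab : a < b)
    (hb : IsExtremal lt H b) : a < firstExtremal lt H a ∧ firstExtremal lt H a ≤ b := by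
  classical
  have hmem : b ∈ H.filter (fun b => a < b ∧ IsExtremal lt H b) :=
    Finset.mem_filter.2 ⟨hb.1, hab, hb⟩
  have h : (H.filter (fun b => a < b ∧ IsExtremal lt H b)).Nonempty := ⟨b, hmem⟩
  have he : firstExtremal lt H a =
      (H.filter (fun b => a < b ∧ IsExtremal lt H b)).min' h := by
    unfold firstExtremal
    rw [← Finset.coe_min' h, WithTop.untopD_coe]
  rw [he]
  exact ⟨(Finset.mem_filter.1 (Finset.min'_mem _ h)).2.1, Finset.min'_le _ _ hmem⟩

/-- The largest letter is always extremal, so a run starting at a letter `a` with `a + 1` in the heap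
has at least two letters. -/
theorem IsPathOrientation.lt_firstExtremal {S : Finset ℕ} {R : ℕ → ℕ → Prop}
    (hR : IsPathOrientation S R) {a c : ℕ} (hca : c < a) (h1 : a + 1 ∈ S) :
    a < firstExtremal (Relation.TransGen R) (S.filter (c < ·)) a := by
  have hne : S.Nonempty := ⟨_, h1⟩
  have hmax : a + 1 ≤ S.max' hne := Finset.le_max' _ _ h1
  have hle : ∀ x ∈ S, x ≤ S.max' hne := fun x hx => Finset.le_max' _ _ hx
  refine (BooleanPermutation.lt_firstExtremal (b := S.max' hne) (by omega)
    ⟨Finset.mem_filter.2 ⟨Finset.max'_mem _ _, by omega⟩, ?_⟩).1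
  -- A largest letter `m` that is neither minimal nor maximal would have a neighbour on either side
  -- of it in the order; both neighbours are `m - 1`.
  generalize S.max' hne = m at *
  by_contra! hcon
  obtain ⟨⟨x, -, hx⟩, ⟨y, -, hy⟩⟩ := hcon
  obtain ⟨u, -, hu⟩ := Relation.TransGen.tail'_iff.1 hx
  obtain ⟨v, hv, -⟩ := Relation.TransGen.head'_iff.1 hy
  have h1 := hle u (hR.mem_left hu)
  have h2 := hle v (hR.mem_right hv)
  have huv : u = v := by
    have := hR.adj hu
    have := hR.adj hv
    omega
  subst huv
  exact hR.asymm hu hv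

/-- The runs occupy disjoint blocks of length at least two, each with one lead. The letters that
remain in the recursive construction are those beyond the last block. -/
theorem IsPathOrientation.sparse_heapLeads {S : Finset ℕ} {R : ℕ → ℕ → Prop}
    (hR : IsPathOrientation S R) (c : ℕ) :
    Sparse c (heapLeads (Relation.TransGen R) (S.filter (c < ·))) ∧
      ∀ x ∈ heapLeads (Relation.TransGen R) (S.filter (c < ·)), c < x := by
  induction hk : S.sup id - c using Nat.strong_induction_on generalizing c with
  | _ k ih =>
  subst hk
  rcases (S.filter (c < ·)).eq_empty_or_nonempty with he | hne
  · rw [he, heapLeads_empty]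
    exact ⟨sparse_empty c, by simp⟩
  obtain ⟨a, ha, hmin⟩ : ∃ a ∈ S.filter (c < ·), ∀ x ∈ S.filter (c < ·), a ≤ x :=
    ⟨_, Finset.min'_mem _ hne, fun x hx => Finset.min'_le _ _ hx⟩
  obtain ⟨ha, hca⟩ := Finset.mem_filter.1 ha
  have hmin' : ∀ x ∈ S, c < x → a ≤ x := fun x hx h => hmin x (Finset.mem_filter.2 ⟨hx, h⟩)
  have hsup : a ≤ S.sup id := Finset.le_sup (f := id) ha
  -- `b` is the end of the block that contains `a`, and `l` is its lead.
  have key : ∀ b l, a + 1 ≤ b → a ≤ l → l ≤ b →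
      heapLeads (Relation.TransGen R) (S.filter (c < ·)) =
        insert l (heapLeads (Relation.TransGen R) (S.filter (b < ·))) →
      Sparse c (heapLeads (Relation.TransGen R) (S.filter (c < ·))) ∧
        ∀ x ∈ heapLeads (Relation.TransGen R) (S.filter (c < ·)), c < x := by
    intro b l hb hal hlb heq
    obtain ⟨h1, h2⟩ := ih (S.sup id - b) (by omega) b rfl
    rw [heq]
    refine ⟨h1.insert h2 (by omega) hlb, ?_⟩
    rintro x (rfl | hx)
    · omega
    · have := h2 x hx
      omega
  by_cases h1 : a + 1 ∈ S
  · have hb := hR.lt_firstExtremal hca h1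
    by_cases hlt : Relation.TransGen R (a + 1) a
    · exact key _ _ hb hb.le le_rfl (heapLeads_dec ha hca hmin' h1 hlt)
    · exact key _ _ hb le_rfl hb.le (heapLeads_inc ha hca hmin' h1 hlt)
  · exact key _ _ le_rfl le_rfl (Nat.le_succ a) (heapLeads_singleton ha hca hmin' h1)

theorem isPathOrientation_heapCover {n : ℕ} (w : Equiv.Perm (Fin n)) :
    IsPathOrientation (support w) (HeapCover w) where
  mem_left h := h.1
  mem_right h := h.2.1
  adj h := h.2.2.imp And.left And.left
  asymm := by
    rintro x y ⟨-, -, h⟩ ⟨-, -, h'⟩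
    rcases h with ⟨h1, h2⟩ | ⟨h1, h2⟩ <;> rcases h' with ⟨h3, h4⟩ | ⟨h3, h4⟩
    · omega
    · exact h4 h2
    · exact h2 h4
    · omega

theorem mem_Ico_of_mem_support {n : ℕ} {w : Equiv.Perm (Fin n)} {i : ℕ} (hi : i ∈ support w) :
    1 ≤ i ∧ i < n := by
  classical
  exact Finset.mem_Ico.1 (Finset.mem_filter.1 hi).1

theorem runLeads_eq_heapLeads {n : ℕ} (w : Equiv.Perm (Fin n)) :
    runLeads w = heapLeads (HeapLT w) ((support w).filter (0 < ·)) := by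
  have : (support w).filter (0 < ·) = support w := by
    refine Finset.filter_true_of_mem fun x hx => ?_
    exact (mem_Ico_of_mem_support hx).1
  rw [this]
  rfl

theorem sparse_runLeads {n : ℕ} (w : Equiv.Perm (Fin n)) : Sparse 0 (runLeads w) := by
  rw [runLeads_eq_heapLeads]
  exact ((isPathOrientation_heapCover w).sparse_heapLeads 0).1

/-! ### A heap with prescribed leads -/

/-- The greedy choice of letters beyond `c`. The set `T` is the whole heap, of which the construction
of runs sees only the part `S` beyond `c`; orienting `T` by `i ≺ i + 1 ↔ i ∈ L` turns `L` into the
set of leads. -/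
theorem exists_heap (n : ℕ) (L : Set ℕ) (hL : ∀ i ∈ L, i < n) (c : ℕ) (hs : Sparse c L) :
    ∃ S ⊆ Finset.Ioo c n, ∀ (T : Finset ℕ) (R : ℕ → ℕ → Prop), T.filter (c < ·) = S →
      IsPathOrientation T R →
      (∀ i, i ∈ T → i + 1 ∈ T → (R i (i + 1) ↔ i ∈ L) ∧ (R (i + 1) i ↔ i ∉ L)) →
      heapLeads (Relation.TransGen R) (T.filter (c < ·)) = {x ∈ L | c < x} := by
  induction hk : n - c using Nat.strong_induction_on generalizing c with
  | _ k ih =>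
  subst hk
  by_cases hcn : n ≤ c + 1
  · refine ⟨∅, by simp, fun T R hT _ _ => ?_⟩
    rw [hT, heapLeads_empty]
    symm
    refine Set.eq_empty_of_forall_notMem ?_
    rintro x ⟨hx, hcx⟩
    have := hL x hx
    omega
  have tail : ∀ {S T : Finset ℕ} {U : Finset ℕ} {d : ℕ}, c ≤ d → S ⊆ Finset.Ioo d n →
      (∀ x ∈ U, x ≤ d) → T.filter (c < ·) = U ∪ S → T.filter (d < ·) = S := by
    intro S T U d hcd hS hU hT
    ext x
    have := Finset.ext_iff.1 hT x
    simp only [Finset.mem_filter, Finset.mem_union] at this ⊢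
    constructor
    · rintro ⟨hx, hdx⟩
      rcases this.1 ⟨hx, by omega⟩ with h | h
      · have := hU x h
        omega
      · exact h
    · intro hx
      exact ⟨(this.2 (Or.inr hx)).1, (Finset.mem_Ioo.1 (hS hx)).1⟩
  by_cases h1 : c + 1 ∈ L
  · have h2 := hs.not_mem_both h1
    obtain ⟨S, hS, hS'⟩ := ih (n - (c + 2)) (by omega) (c + 2)
      (hs.add_two h1 (by omega) (by omega)) rfl
    refine ⟨{c + 1} ∪ S, ?_, fun T R hT hR hRL => ?_⟩
    · intro x hx
      rcases Finset.mem_union.1 hx with h | h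
      · rw [Finset.mem_singleton.1 h, Finset.mem_Ioo]
        omega
      · have := Finset.mem_Ioo.1 (hS h)
        exact Finset.mem_Ioo.2 (by omega)
    · have hT' := tail (d := c + 2) (by omega) hS (by simp) hT
      have hmem : c + 1 ∈ T := (Finset.mem_filter.1 (hT ▸ by simp : c + 1 ∈ T.filter (c < ·))).1
      have hnot : c + 1 + 1 ∉ T := by
        intro h
        have h' : c + 2 ∈ T.filter (c < ·) := Finset.mem_filter.2 ⟨h, by omega⟩
        rw [hT, Finset.mem_union, Finset.mem_singleton] at h'
        rcases h' with h' | h'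
        · omega
        · have := Finset.mem_Ioo.1 (hS h')
          omega
      rw [heapLeads_singleton hmem (by omega) (fun x _ hx => hx) hnot, hS' T R hT' hR hRL]
      ext x
      simp only [Set.mem_insert_iff, Set.mem_ofPred_eq]
      constructor
      · rintro (rfl | ⟨hx, hcx⟩)
        · exact ⟨h1, by omega⟩
        · exact ⟨hx, by omega⟩
      · rintro ⟨hx, hcx⟩
        have : x ≠ c + 2 := by rintro rfl; exact h2 hx
        by_cases hxc : x = c + 1
        · exact Or.inl hxc
        · exact Or.inr ⟨hx, by omega⟩
  by_cases h2 : c + 2 ∈ L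
  · obtain ⟨S, hS, hS'⟩ := ih (n - (c + 2)) (by omega) (c + 2)
      (hs.add_two h2 (by omega) (by omega)) rfl
    refine ⟨{c + 1, c + 2} ∪ S, ?_, fun T R hT hR hRL => ?_⟩
    · intro x hx
      have := hL _ h2
      rcases Finset.mem_union.1 hx with h | h
      · simp only [Finset.mem_insert, Finset.mem_singleton] at h
        exact Finset.mem_Ioo.2 (by omega)
      · have := Finset.mem_Ioo.1 (hS h)
        exact Finset.mem_Ioo.2 (by omega)
    · have hT' := tail (d := c + 2) (by omega) hS (by simp) hT
      have hm1 : c + 1 ∈ T := (Finset.mem_filter.1 (hT ▸ by simp : c + 1 ∈ T.filter (c < ·))).1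
      have hm2 : c + 1 + 1 ∈ T :=
        (Finset.mem_filter.1 (hT ▸ by simp : c + 1 + 1 ∈ T.filter (c < ·))).1
      -- The end `c + 2 ∈ L` of the block is minimal, since it lies below each of its neighbours.
      have hext : IsExtremal (Relation.TransGen R) (T.filter (c < ·)) (c + 1 + 1) := by
        refine ⟨Finset.mem_filter.2 ⟨hm2, by omega⟩, Or.inl fun x _ hx => ?_⟩
        obtain ⟨u, -, hu⟩ := Relation.TransGen.tail'_iff.1 hx
        have huT := hR.mem_left hu
        rcases hR.adj hu with h | h
        · obtain rfl : u = c + 1 := by omega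
          exact h1 ((hRL _ hm1 hm2).1.1 hu)
        · subst h
          exact (hRL _ hm2 huT).2.1 hu h2
      have hfe := lt_firstExtremal (Nat.lt_succ_self (c + 1)) hext
      have hfe' : firstExtremal (Relation.TransGen R) (T.filter (c < ·)) (c + 1) = c + 2 :=
        le_antisymm hfe.2 hfe.1
      rw [heapLeads_dec hm1 (by omega) (fun x _ hx => hx) hm2
        (Relation.TransGen.single ((hRL _ hm1 hm2).2.2 h1)), hfe', hS' T R hT' hR hRL]
      ext x
      simp only [Set.mem_insert_iff, Set.mem_ofPred_eq]
      constructor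
      · rintro (rfl | ⟨hx, hcx⟩)
        · exact ⟨h2, by omega⟩
        · exact ⟨hx, by omega⟩
      · rintro ⟨hx, hcx⟩
        have : x ≠ c + 1 := by rintro rfl; exact h1 hx
        by_cases hxc : x = c + 2
        · exact Or.inl hxc
        · exact Or.inr ⟨hx, by omega⟩
  · obtain ⟨S, hS, hS'⟩ := ih (n - (c + 1)) (by omega) (c + 1) (hs.succ h2) rfl
    refine ⟨S, fun x hx => ?_, fun T R hT hR hRL => ?_⟩
    · have := Finset.mem_Ioo.1 (hS hx)
      exact Finset.mem_Ioo.2 (by omega)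
    · have hT' : T.filter (c + 1 < ·) = S :=
        tail (U := ∅) (by omega) hS (by simp) (by simpa using hT)
      rw [hT, ← hT', hS' T R hT' hR hRL]
      ext x
      simp only [Set.mem_ofPred_eq]
      constructor
      · rintro ⟨hx, hcx⟩
        exact ⟨hx, by omega⟩
      · rintro ⟨hx, hcx⟩
        have : x ≠ c + 1 := by rintro rfl; exact h1 hx
        exact ⟨hx, by omega⟩

/-! ### Words in the simple reflections -/

section Words

open scoped List

variable {n : ℕ}

theorem simpleReflection_val {i : ℕ} (h : 1 ≤ i ∧ i < n) (x : Fin n) :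
    (simpleReflection n i x).val =
      if x.val = i - 1 then i else if x.val = i then i - 1 else x.val := by
  rw [simpleReflection, dif_pos h, Equiv.swap_apply_def]
  simp only [Fin.ext_iff]
  split_ifs <;> rfl

theorem simpleReflection_mul_self (n i : ℕ) :
    simpleReflection n i * simpleReflection n i = 1 := by
  unfold simpleReflection
  split_ifs
  · exact Equiv.swap_mul_self _ _
  · rfl

@[simp] theorem wordProd_nil : wordProd n [] = 1 := rfl

@[simp] theorem wordProd_cons (i : ℕ) (s : List ℕ) :
    wordProd n (i :: s) = simpleReflection n i * wordProd n s := by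
  simp [wordProd]

@[simp] theorem wordProd_append (s t : List ℕ) :
    wordProd n (s ++ t) = wordProd n s * wordProd n t := by
  simp [wordProd]

theorem IsWord.subset {s t : List ℕ} (h : IsWord n t) (hst : s ⊆ t) : IsWord n s :=
  fun i hi => h i (hst hi)

theorem exists_word (w : Equiv.Perm (Fin n)) : ∃ s, IsWord n s ∧ wordProd n s = w := by
  rcases n with _ | n
  · exact ⟨[], by simp [IsWord], Subsingleton.elim _ _⟩
  have hw : w ∈ Submonoid.closure
      (Set.range fun i : Fin n => Equiv.swap i.castSucc i.succ) := by
    rw [Equiv.Perm.mclosure_swap_castSucc_succ]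
    trivial
  induction hw using Submonoid.closure_induction with
  | mem x hx =>
    obtain ⟨i, rfl⟩ := hx
    refine ⟨[i.val + 1], by simp [IsWord], ?_⟩
    have h : 1 ≤ i.val + 1 ∧ i.val + 1 < n + 1 := by omega
    simp only [wordProd_cons, wordProd_nil, mul_one]
    rw [simpleReflection, dif_pos h]
    rfl
  | one => exact ⟨[], by simp [IsWord], rfl⟩
  | mul x y _ _ hx hy =>
    obtain ⟨s, hs, rfl⟩ := hx
    obtain ⟨t, ht, rfl⟩ := hy
    refine ⟨s ++ t, fun i hi => ?_, wordProd_append s t⟩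
    exact (List.mem_append.1 hi).elim (hs i) (ht i)

theorem length_wordProd_le {s : List ℕ} (hs : IsWord n s) :
    length (wordProd n s) ≤ s.length :=
  Nat.sInf_le ⟨s, hs, rfl, rfl⟩

theorem exists_reducedWord (w : Equiv.Perm (Fin n)) : ∃ s, IsReducedWord w s := by
  obtain ⟨s, hs, hw⟩ := exists_word w
  obtain ⟨t, ht, htw, hl⟩ := Nat.sInf_mem
    (s := {l : ℕ | ∃ s : List ℕ, IsWord n s ∧ wordProd n s = w ∧ s.length = l})
    ⟨_, s, hs, hw, rfl⟩
  exact ⟨t, ht, htw, hl⟩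

/-- Strong exchange: if `w` inverts the pair `i < j`, then among the letters of a word of `w`, read
from right to left, one first swaps the images of `i` and `j`; multiplying `w` by the
transposition of `i` and `j` deletes this letter. -/
theorem exchange {s : List ℕ} (hs : IsWord n s) {i j : Fin n} (hij : i < j)
    (hinv : wordProd n s j < wordProd n s i) :
    ∃ m < s.length, wordProd n s * Equiv.swap i j = wordProd n (s.eraseIdx m) := by
  induction s with
  | nil => exact absurd hinv (by simpa using hij.le)
  | cons a t ih =>
    have ha := hs a (by simp)
    have ht : IsWord n t := hs.subset (by simp)
    by_cases h : wordProd n t j < wordProd n t i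
    · obtain ⟨m, hm, he⟩ := ih ht h
      exact ⟨m + 1, by simpa using hm, by simp [mul_assoc, he]⟩
    · refine ⟨0, by simp, ?_⟩
      have hne : (wordProd n t i).val ≠ (wordProd n t j).val := fun h =>
        hij.ne ((wordProd n t).injective (Fin.ext h))
      have hv : (wordProd n t i).val = a - 1 ∧ (wordProd n t j).val = a := by
        rw [Fin.lt_def] at h hinv
        simp only [wordProd_cons, Equiv.Perm.mul_apply, simpleReflection_val ha] at hinv
        split_ifs at hinv <;> omega
      have hsa : simpleReflection n a = Equiv.swap (wordProd n t i) (wordProd n t j) := by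
        rw [simpleReflection, dif_pos ha]
        congr 1 <;> exact Fin.ext (by simp [hv])
      rw [wordProd_cons, mul_assoc, Equiv.mul_swap_eq_swap_mul, ← hsa, ← mul_assoc,
        simpleReflection_mul_self, one_mul]
      rfl

/-- A Bruhat step down from a product of simple reflections deletes a letter. If the pair of the
transposition were not inverted upstairs, it would be inverted in `u`, and exchange in a reduced
word of `u` would make the upper element shorter than `u`. -/
theorem BruhatStep.exists_eraseIdx {u : Equiv.Perm (Fin n)} {s : List ℕ} (hs : IsWord n s)
    (h : BruhatStep u (wordProd n s)) :
    ∃ m < s.length, u = wordProd n (s.eraseIdx m) := by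
  obtain ⟨i, j, hij, hv, hl⟩ := h
  wlog hlt : i < j generalizing i j
  · exact this j i hij.symm (by rw [hv, Equiv.swap_comm]) (lt_of_le_of_ne (not_lt.1 hlt) hij.symm)
  have hu : u = wordProd n s * Equiv.swap i j := by
    rw [hv, mul_assoc, Equiv.swap_mul_self, mul_one]
  by_cases hinv : wordProd n s j < wordProd n s i
  · obtain ⟨m, hm, he⟩ := exchange hs hlt hinv
    exact ⟨m, hm, hu.trans he⟩
  · exfalso
    obtain ⟨t, ht, htu, htl⟩ := exists_reducedWord u
    -- If the upper element does not invert `i < j`, then `u` does.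
    have hinv' : wordProd n t j < wordProd n t i := by
      rw [htu, hu]
      simp only [Equiv.Perm.mul_apply, Equiv.swap_apply_left, Equiv.swap_apply_right]
      exact lt_of_le_of_ne (not_lt.1 hinv) fun h => hij ((wordProd n s).injective h)
    obtain ⟨m, hm, he⟩ := exchange ht hlt hinv'
    rw [htu, ← hv] at he
    have h1 := length_wordProd_le (ht.subset (t.eraseIdx_sublist m).subset)
    rw [← he] at h1
    have h2 := List.length_eraseIdx_of_lt hm
    omega

/-- A product of simple reflections other than `s_i` preserves `{x | x < i}`. -/
theorem wordProd_lt_iff {s : List ℕ} (hs : IsWord n s) {i : ℕ} (hi : i ∉ s) (x : Fin n) :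
    (wordProd n s x).val < i ↔ x.val < i := by
  induction s with
  | nil => rfl
  | cons a t ih =>
    have ha := hs a (by simp)
    rw [List.mem_cons, not_or] at hi
    rw [← ih (hs.subset (by simp)) hi.2, wordProd_cons, Equiv.Perm.mul_apply,
      simpleReflection_val ha]
    split_ifs <;> omega

theorem not_mem_of_nodup_middle {u v : List ℕ} {i : ℕ} (hnd : (u ++ i :: v).Nodup) :
    i ∉ u ∧ i ∉ v := by
  rw [List.nodup_middle, List.nodup_cons, List.mem_append, not_or] at hnd
  exact hnd.1

/-- Conversely to `wordProd_lt_iff`, a letter `i` that occurs exactly once moves an element out of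
`{x | x < i}`. -/
theorem exists_crossing {s : List ℕ} (hs : IsWord n s) (hnd : s.Nodup) {i : ℕ} (hi : i ∈ s) :
    ∃ x : Fin n, x.val < i ∧ i ≤ (wordProd n s x).val := by
  have hin := hs i hi
  obtain ⟨s₁, s₂, rfl⟩ := List.append_of_mem hi
  obtain ⟨h₁, h₂⟩ := not_mem_of_nodup_middle hnd
  have hw₁ : IsWord n s₁ := hs.subset (by simp)
  have hw₂ : IsWord n s₂ := hs.subset fun x hx => by simp [hx]
  refine ⟨(wordProd n s₂).symm ⟨i - 1, by omega⟩, ?_, ?_⟩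
  · rw [← wordProd_lt_iff hw₂ h₂, Equiv.apply_symm_apply]
    simp only
    omega
  · rw [← not_lt, wordProd_append, wordProd_cons, Equiv.Perm.mul_apply, Equiv.Perm.mul_apply,
      Equiv.apply_symm_apply, wordProd_lt_iff hw₁ h₁, simpleReflection_val hin]
    simp

theorem subset_of_wordProd_eq {s t : List ℕ} (hs : IsWord n s) (hnd : s.Nodup)
    (ht : IsWord n t) (h : wordProd n t = wordProd n s) : s ⊆ t := by
  intro i hi
  by_contra hit
  obtain ⟨x, hx, hx'⟩ := exists_crossing hs hnd hi
  rw [← h] at hx'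
  have := (wordProd_lt_iff ht hit x).2 hx
  omega

theorem length_wordProd {s : List ℕ} (hs : IsWord n s) (hnd : s.Nodup) :
    length (wordProd n s) = s.length := by
  refine le_antisymm (length_wordProd_le hs) ?_
  obtain ⟨t, ht, htw, htl⟩ := exists_reducedWord (wordProd n s)
  rw [← htl]
  exact (hnd.subperm (subset_of_wordProd_eq hs hnd ht htw)).length_le

theorem IsReducedWord.perm {s t : List ℕ} (hs : IsWord n s) (hnd : s.Nodup)
    (ht : IsReducedWord (wordProd n s) t) : s.Perm t := by
  obtain ⟨ht, htw, htl⟩ := ht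
  refine (hnd.subperm (subset_of_wordProd_eq hs hnd ht htw)).perm_of_length_le ?_
  rw [htl, length_wordProd hs hnd]

theorem isReducedWord_wordProd {s : List ℕ} (hs : IsWord n s) (hnd : s.Nodup) :
    IsReducedWord (wordProd n s) s :=
  ⟨hs, rfl, (length_wordProd hs hnd).symm⟩

theorem support_wordProd {s : List ℕ} (hs : IsWord n s) (hnd : s.Nodup) :
    support (wordProd n s) = s.toFinset := by
  ext i
  simp only [support, Finset.mem_filter, Finset.mem_Ico, List.mem_toFinset]
  constructor
  · rintro ⟨-, t, ht, hi⟩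
    exact (IsReducedWord.perm hs hnd ht).mem_iff.2 hi
  · exact fun hi => ⟨hs i hi, s, isReducedWord_wordProd hs hnd, hi⟩

/-- If `i` is to the left of `i + 1`, then the element `i` is fixed until `s_{i+1}` sends it to
`i + 1`, and no later letter brings it back below `i + 1`. -/
theorem lt_wordProd_of_sublist {s : List ℕ} (hs : IsWord n s) (hnd : s.Nodup) {i : ℕ}
    (hin : i < n) (h : [i, i + 1] <+ s) : i < (wordProd n s ⟨i, hin⟩).val := by
  obtain ⟨r, q, rfl, hi, hq⟩ := List.cons_sublist_iff.1 h
  obtain ⟨u, v, rfl⟩ := List.append_of_mem (List.singleton_sublist.1 hq)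
  have hw := hs (i + 1) (by simp)
  rw [← List.append_assoc] at hs hnd ⊢
  obtain ⟨h₁, h₂⟩ := not_mem_of_nodup_middle hnd
  have h₃ : i ∉ v := fun h => by
    rw [List.nodup_append] at hnd
    exact hnd.2.2 i (by simp [hi]) i (by simp [h]) rfl
  have hv : IsWord n v := hs.subset fun x hx => by simp [hx]
  have e₁ := wordProd_lt_iff hv h₂ ⟨i, hin⟩
  have e₂ := wordProd_lt_iff hv h₃ ⟨i, hin⟩
  have e₃ := wordProd_lt_iff (hs.subset (by simp : r ++ u ⊆ _)) h₁
    (simpleReflection n (i + 1) (wordProd n v ⟨i, hin⟩))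
  rw [simpleReflection_val hw] at e₃
  simp only [wordProd_append, wordProd_cons, Equiv.Perm.mul_apply] at e₁ e₂ e₃ ⊢
  split_ifs at e₃ <;> omega

/-- If `i + 1` is to the left of `i`, then the element `i` is fixed until `s_i` sends it to `i - 1`,
and no later letter brings it back to `i`. -/
theorem wordProd_lt_of_sublist {s : List ℕ} (hs : IsWord n s) (hnd : s.Nodup) {i : ℕ}
    (hin : i < n) (h : [i + 1, i] <+ s) : (wordProd n s ⟨i, hin⟩).val < i := by
  obtain ⟨r, q, rfl, hi, hq⟩ := List.cons_sublist_iff.1 h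
  obtain ⟨u, v, rfl⟩ := List.append_of_mem (List.singleton_sublist.1 hq)
  have hw := hs i (by simp)
  rw [← List.append_assoc] at hs hnd ⊢
  obtain ⟨h₁, h₂⟩ := not_mem_of_nodup_middle hnd
  have h₃ : i + 1 ∉ v := fun h => by
    rw [List.nodup_append] at hnd
    exact hnd.2.2 (i + 1) (by simp [hi]) (i + 1) (by simp [h]) rfl
  have hv : IsWord n v := hs.subset fun x hx => by simp [hx]
  have e₁ := wordProd_lt_iff hv h₂ ⟨i, hin⟩
  have e₂ := wordProd_lt_iff hv h₃ ⟨i, hin⟩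
  have e₃ := wordProd_lt_iff (hs.subset (by simp : r ++ u ⊆ _)) h₁
    (simpleReflection n i (wordProd n v ⟨i, hin⟩))
  rw [simpleReflection_val hw] at e₃
  simp only [wordProd_append, wordProd_cons, Equiv.Perm.mul_apply] at e₁ e₂ e₃ ⊢
  split_ifs at e₃ <;> omega

theorem pair_sublist_or {s : List ℕ} {i j : ℕ} (hi : i ∈ s) (hj : j ∈ s) (hij : i ≠ j) :
    [i, j] <+ s ∨ [j, i] <+ s := by
  obtain ⟨u, v, rfl⟩ := List.append_of_mem hj
  simp only [List.mem_append, List.mem_cons, hij, false_or] at hi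
  rcases hi with hi | hi
  · exact Or.inl (List.cons_sublist_iff.2 ⟨u, _, rfl, hi, by simp⟩)
  · right
    exact (List.Sublist.cons_cons j (List.singleton_sublist.2 hi)).trans
      (List.sublist_append_right u (j :: v))

theorem alwaysLeft_wordProd_iff {s : List ℕ} (hs : IsWord n s) (hnd : s.Nodup) {i : ℕ}
    (hi : i ∈ s) (hi' : i + 1 ∈ s) :
    AlwaysLeft (wordProd n s) i (i + 1) ↔ [i, i + 1] <+ s := by
  refine ⟨fun h => h s (isReducedWord_wordProd hs hnd), fun h t ht => ?_⟩
  have hp := IsReducedWord.perm hs hnd ht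
  rcases pair_sublist_or (hp.mem_iff.1 hi) (hp.mem_iff.1 hi') (by omega) with h' | h'
  · exact h'
  · have h1 := lt_wordProd_of_sublist hs hnd (hs i hi).2 h
    have h2 := wordProd_lt_of_sublist ht.1 (hp.nodup_iff.1 hnd) (hs i hi).2 h'
    rw [ht.2.1] at h2
    omega

/-! ### Words without repeated letters are boolean -/

theorem bruhatStep_delete {u v : List ℕ} {b : ℕ} (hs : IsWord n (u ++ b :: v))
    (hnd : (u ++ b :: v).Nodup) :
    BruhatStep (wordProd n (u ++ v)) (wordProd n (u ++ b :: v)) := by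
  have hb := hs b (by simp)
  have hsub : (u ++ v) <+ (u ++ b :: v) := (List.sublist_cons_self b v).append_left u
  refine ⟨(wordProd n v).symm ⟨b - 1, by omega⟩, (wordProd n v).symm ⟨b, hb.2⟩, ?_, ?_, ?_⟩
  · intro h
    have := Fin.ext_iff.1 ((wordProd n v).symm.injective h)
    simp only at this
    omega
  · rw [wordProd_append, wordProd_append, wordProd_cons, mul_assoc,
      Equiv.mul_swap_eq_swap_mul, Equiv.apply_symm_apply, Equiv.apply_symm_apply,
      simpleReflection, dif_pos hb]
  · rw [length_wordProd hs hnd, length_wordProd (hs.subset hsub.subset) (hnd.sublist hsub)]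
    simp

theorem exists_of_bruhatLE {s : List ℕ} (hs : IsWord n s) {u : Equiv.Perm (Fin n)}
    (h : BruhatLE u (wordProd n s)) : ∃ t, t <+ s ∧ u = wordProd n t := by
  induction h using Relation.ReflTransGen.head_induction_on with
  | refl => exact ⟨s, List.Sublist.refl s, rfl⟩
  | head h _ ih =>
    obtain ⟨t, ht, rfl⟩ := ih
    obtain ⟨m, -, he⟩ := h.exists_eraseIdx (hs.subset ht.subset)
    exact ⟨_, (t.eraseIdx_sublist m).trans ht, he⟩

theorem bruhatLE_filter_union {s : List ℕ} (hs : IsWord n s) (hnd : s.Nodup)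
    (A D : Finset ℕ) :
    BruhatLE (wordProd n (s.filter (· ∈ A))) (wordProd n (s.filter (· ∈ A ∪ D))) := by
  induction D using Finset.induction_on with
  | empty => rw [Finset.union_empty]; exact Relation.ReflTransGen.refl
  | insert d D _ ih =>
    refine Relation.ReflTransGen.trans ih ?_
    by_cases hd : d ∈ s ∧ d ∉ A ∪ D
    · obtain ⟨hds, hdA⟩ := hd
      obtain ⟨u, v, rfl⟩ := List.append_of_mem hds
      obtain ⟨hdu, hdv⟩ := not_mem_of_nodup_middle hnd
      have hcongr : ∀ q : List ℕ, d ∉ q →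
          q.filter (· ∈ A ∪ insert d D) = q.filter (· ∈ A ∪ D) := by
        intro q hq
        refine List.filter_congr fun x hx => ?_
        have : x ≠ d := by rintro rfl; exact hq hx
        simp [this]
      have e1 : (u ++ d :: v).filter (· ∈ A ∪ D) =
          u.filter (· ∈ A ∪ D) ++ v.filter (· ∈ A ∪ D) := by
        rw [List.filter_append, List.filter_cons_of_neg (by simpa using hdA)]
      have e2 : (u ++ d :: v).filter (· ∈ A ∪ insert d D) =
          u.filter (· ∈ A ∪ D) ++ d :: v.filter (· ∈ A ∪ D) := by
        rw [List.filter_append, List.filter_cons_of_pos (by simp), hcongr u hdu, hcongr v hdv]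
      have hsub := List.filter_sublist (l := u ++ d :: v) (p := (· ∈ A ∪ insert d D))
      rw [e1, e2]
      rw [e2] at hsub
      exact Relation.ReflTransGen.single
        (bruhatStep_delete (hs.subset hsub.subset) (hnd.sublist hsub))
    · have : s.filter (· ∈ A ∪ insert d D) = s.filter (· ∈ A ∪ D) := by
        refine List.filter_congr fun x hx => ?_
        by_cases hxd : x = d
        · subst hxd
          have : x ∈ A ∪ D := by
            by_contra h
            exact hd ⟨hx, h⟩
          simp only [Finset.mem_union] at this
          simp only [Finset.mem_union, Finset.mem_insert, decide_eq_decide]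
          tauto
        · simp [hxd]
      rw [this]

theorem filter_mem_toFinset_of_sublist {s t : List ℕ} (hnd : s.Nodup) (hts : t <+ s) :
    s.filter (· ∈ t.toFinset) = t := by
  induction hts with
  | slnil => rfl
  | @cons t s a h ih =>
    obtain ⟨ha, hnd⟩ := List.nodup_cons.1 hnd
    rw [List.filter_cons_of_neg, ih hnd]
    simpa using fun hat => ha (h.subset hat)
  | @cons_cons t s a h ih =>
    obtain ⟨ha, hnd⟩ := List.nodup_cons.1 hnd
    rw [List.filter_cons_of_pos (by simp)]
    congr 1
    rw [← ih hnd]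
    refine List.filter_congr fun x hx => ?_
    have : x ≠ a := by rintro rfl; exact ha hx
    simp [this, hx]

theorem bruhatLE_wordProd_iff {s t : List ℕ} (hs : IsWord n s) (hnd : s.Nodup)
    (hts : t <+ s) {A : Finset ℕ} :
    BruhatLE (wordProd n t) (wordProd n (s.filter (· ∈ A))) ↔ t.toFinset ⊆ A := by
  constructor
  · intro h
    obtain ⟨q, hq, he⟩ := exists_of_bruhatLE (hs.subset (List.filter_sublist).subset) h
    intro i hi
    have hiq := subset_of_wordProd_eq (hs.subset hts.subset) (hnd.sublist hts)
      (hs.subset (hq.trans List.filter_sublist).subset) he.symm (List.mem_toFinset.1 hi)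
    simpa using (List.mem_filter.1 (hq.subset hiq)).2
  · intro h
    have := bruhatLE_filter_union hs hnd t.toFinset A
    rwa [filter_mem_toFinset_of_sublist hnd hts, Finset.union_eq_right.2 h] at this

theorem isBoolean_wordProd {s : List ℕ} (hs : IsWord n s) (hnd : s.Nodup) :
    IsBoolean (wordProd n s) := by
  have hinj : Function.Injective s.get := List.nodup_iff_injective_get.1 hnd
  have hfull : s.filter (· ∈ s.toFinset) = s :=
    filter_mem_toFinset_of_sublist hnd (List.Sublist.refl s)
  have hle : ∀ t, t <+ s → BruhatLE (wordProd n t) (wordProd n s) := by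
    intro t ht
    have := (bruhatLE_wordProd_iff hs hnd ht (A := s.toFinset)).2
      fun x hx => List.mem_toFinset.2 (ht.subset (List.mem_toFinset.1 hx))
    rwa [hfull] at this
  -- The subword of `s` at a set of positions.
  let t : Finset (Fin s.length) → List ℕ := fun A => s.filter (· ∈ A.image s.get)
  have hts : ∀ A, t A <+ s := fun A => List.filter_sublist
  have htA : ∀ A, (t A).toFinset = A.image s.get := by
    intro A
    ext x
    simp only [t, List.mem_toFinset, List.mem_filter, decide_eq_true_eq]
    refine and_iff_right_of_imp fun h => ?_
    obtain ⟨j, -, rfl⟩ := Finset.mem_image.1 h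
    exact List.get_mem s j
  have hiff : ∀ A B, BruhatLE (wordProd n (t A)) (wordProd n (t B)) ↔ A ⊆ B := by
    intro A B
    rw [bruhatLE_wordProd_iff hs hnd (hts A), htA, Finset.image_subset_image_iff hinj]
  let f : Finset (Fin s.length) → {u : Equiv.Perm (Fin n) // BruhatLE u (wordProd n s)} :=
    fun A => ⟨wordProd n (t A), hle _ (hts A)⟩
  have hf : Function.Bijective f := by
    constructor
    · intro A B h
      have h' : wordProd n (t A) = wordProd n (t B) := congrArg Subtype.val h
      refine subset_antisymm ((hiff A B).1 ?_) ((hiff B A).1 ?_)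
      · rw [h']
        exact Relation.ReflTransGen.refl
      · rw [h']
        exact Relation.ReflTransGen.refl
    · rintro ⟨u, hu⟩
      obtain ⟨q, hq, rfl⟩ := exists_of_bruhatLE hs hu
      refine ⟨Finset.univ.filter (s.get · ∈ q), Subtype.ext ?_⟩
      have : (Finset.univ.filter (s.get · ∈ q)).image s.get = q.toFinset := by
        ext x
        simp only [Finset.mem_image, Finset.mem_filter, Finset.mem_univ, true_and,
          List.mem_toFinset]
        constructor
        · rintro ⟨j, hj, rfl⟩
          exact hj
        · intro hx
          obtain ⟨j, rfl⟩ := List.mem_iff_get.1 (hq.subset hx)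
          exact ⟨j, hx, rfl⟩
      simp only [f, t]
      rw [this, filter_mem_toFinset_of_sublist hnd hq]
  exact ⟨s.length, ⟨(RelIso.mk (Equiv.ofBijective f hf) (fun {A B} => hiff A B)).symm⟩⟩

/-! ### Realizing an orientation -/

open Classical in
/-- A word with the letters of `S` in `{1, …, m}`, each once, in which `i` is to the left of `i + 1`
exactly when `i ∈ L`: each new letter is larger than all earlier ones, and goes to one of the ends. -/
noncomputable def orientedWord (S : Finset ℕ) (L : Set ℕ) : ℕ → List ℕ
  | 0 => []
  | m + 1 =>
    if m + 1 ∈ S then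
      if m ∈ L then orientedWord S L m ++ [m + 1] else (m + 1) :: orientedWord S L m
    else orientedWord S L m

theorem mem_orientedWord {S : Finset ℕ} {L : Set ℕ} {m i : ℕ} :
    i ∈ orientedWord S L m ↔ i ∈ S ∧ 1 ≤ i ∧ i ≤ m := by
  induction m with
  | zero => simp only [orientedWord, List.not_mem_nil, false_iff]; omega
  | succ m ih =>
    by_cases hi : i = m + 1
    · subst hi
      simp only [orientedWord]
      split_ifs <;> simp_all
    · have h : i ∈ orientedWord S L (m + 1) ↔ i ∈ orientedWord S L m := by
        simp only [orientedWord]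
        split_ifs <;> simp [hi]
      rw [h, ih]
      have : i ≤ m ↔ i ≤ m + 1 := by omega
      rw [this]

theorem nodup_orientedWord (S : Finset ℕ) (L : Set ℕ) (m : ℕ) : (orientedWord S L m).Nodup := by
  induction m with
  | zero => simp [orientedWord]
  | succ m ih =>
    have hm : m + 1 ∉ orientedWord S L m := fun h => by
      have := (mem_orientedWord.1 h).2.2
      omega
    simp only [orientedWord]
    split_ifs
    · exact (List.perm_append_singleton _ _).nodup_iff.2 (List.nodup_cons.2 ⟨hm, ih⟩)
    · exact List.nodup_cons.2 ⟨hm, ih⟩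
    · exact ih

theorem pair_sublist_orientedWord {S : Finset ℕ} {L : Set ℕ} {m i : ℕ} (hi : 1 ≤ i)
    (hiS : i ∈ S) (hiS' : i + 1 ∈ S) (him : i + 1 ≤ m) :
    (i ∈ L → [i, i + 1] <+ orientedWord S L m) ∧
      (i ∉ L → [i + 1, i] <+ orientedWord S L m) := by
  induction m with
  | zero => omega
  | succ m ih =>
    by_cases hm : i = m
    · subst hm
      have hmem : [i] <+ orientedWord S L i :=
        List.singleton_sublist.2 (mem_orientedWord.2 ⟨hiS, hi, le_rfl⟩)
      constructor
      · intro h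
        simp only [orientedWord, hiS', h, if_true]
        exact hmem.append_right [i + 1]
      · intro h
        simp only [orientedWord, hiS', h, if_true, if_false]
        exact hmem.cons_cons (i + 1)
    · have hsub : orientedWord S L m <+ orientedWord S L (m + 1) := by
        simp only [orientedWord]
        split_ifs <;> simp
      obtain ⟨h1, h2⟩ := ih (by omega)
      exact ⟨fun h => (h1 h).trans hsub, fun h => (h2 h).trans hsub⟩

theorem exists_isBoolean_of_orientation {S : Finset ℕ} (hS : S ⊆ Finset.Ioo 0 n) (L : Set ℕ) :
    ∃ w : Equiv.Perm (Fin n), IsBoolean w ∧ support w = S ∧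
      ∀ i ∈ S, i + 1 ∈ S → (AlwaysLeft w i (i + 1) ↔ i ∈ L) := by
  set s := orientedWord S L n with hs_def
  have hmem : ∀ i, i ∈ s ↔ i ∈ S := by
    intro i
    rw [hs_def, mem_orientedWord]
    refine and_iff_left_of_imp fun h => ?_
    have := Finset.mem_Ioo.1 (hS h)
    omega
  have hs : IsWord n s := by
    intro i hi
    have := Finset.mem_Ioo.1 (hS ((hmem i).1 hi))
    omega
  have hnd : s.Nodup := nodup_orientedWord S L n
  refine ⟨wordProd n s, isBoolean_wordProd hs hnd, ?_, fun i hi hi' => ?_⟩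
  · rw [support_wordProd hs hnd]
    ext i
    rw [List.mem_toFinset, hmem]
  · rw [alwaysLeft_wordProd_iff hs hnd ((hmem i).2 hi) ((hmem _).2 hi')]
    have h1 := Finset.mem_Ioo.1 (hS hi)
    have h2 := Finset.mem_Ioo.1 (hS hi')
    obtain ⟨h3, h4⟩ := pair_sublist_orientedWord (L := L) (by omega) hi hi' h2.2.le
    refine ⟨fun h => ?_, h3⟩
    by_contra hiL
    have h5 := lt_wordProd_of_sublist hs hnd h1.2 h
    have h6 := wordProd_lt_of_sublist hs hnd h1.2 (h4 hiL)
    omega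

end Words

theorem exists_isBoolean_runLeads_eq {n : ℕ} {L : Set ℕ} (hL : ∀ i ∈ L, 1 ≤ i ∧ i < n)
    (hs : Sparse 0 L) : ∃ w : Equiv.Perm (Fin n), IsBoolean w ∧ runLeads w = L := by
  obtain ⟨S, hS, h⟩ := exists_heap n L (fun i hi => (hL i hi).2) 0 hs
  obtain ⟨w, hw, hwS, hwL⟩ := exists_isBoolean_of_orientation hS L
  refine ⟨w, hw, ?_⟩
  have hfilter : (support w).filter (0 < ·) = S := by
    rw [hwS]
    exact Finset.filter_true_of_mem fun x hx => (Finset.mem_Ioo.1 (hS hx)).1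
  rw [runLeads_eq_heapLeads, HeapLT, h (support w) (HeapCover w) hfilter
    (isPathOrientation_heapCover w)]
  · ext x
    simp only [Set.mem_ofPred_eq]
    exact and_iff_left_of_imp fun hx => (hL x hx).1
  · intro i hi hi'
    rw [← hwL i (hwS ▸ hi) (hwS ▸ hi')]
    have hne : i ≠ i + 1 + 1 := by omega
    simp [HeapCover, hi, hi', hne]

end BooleanPermutation

theorem theorem5p3 (n : ℕ) (L : Set ℕ) (hL : ∀ i ∈ L, 1 ≤ i ∧ i < n) :
    BooleanPermutation.Uncrowded ((fun i : ℕ => (i : ℤ)) '' L ∪ {0}) ↔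
      ∃ w : Equiv.Perm (Fin n),
        BooleanPermutation.IsBoolean w ∧ BooleanPermutation.runLeads w = L := by
  rw [BooleanPermutation.uncrowded_iff_sparse fun i hi => (hL i hi).1]
  constructor
  · exact BooleanPermutation.exists_isBoolean_runLeads_eq hL
  · rintro ⟨w, -, rfl⟩
    exact BooleanPermutation.sparse_runLeads w
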